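/- Let $n\ge 1$. For a probability measure $\mu$ on $\mathbb{R}^n$ (with Lebesgue measure $dx$), let $h(\mu) = -\int \log\left(\frac{d\mu}{dx}\right) d\mu$ denote its Shannon (differential) entropy, whenever $\mu$ is absolutely continuous with respect to Lebesgue measure and the integral exists, with the convention $h(\mu) = -\infty$ if $\mu$ is not absolutely continuous; write $h(X)=h(\mu)$ if the random vector $X$ has law $\mu$. For jointly distributed random vectors $X,Z$, let $I(X;Z)\in[0,+\infty]$ denote their mutual information, i.e. the relative entropy of the joint law of $(X,Z)$ with respect to the product of its marginals. Proposition. Let $X\sim N(0,\operatorname{id}_{\mathbb{R}^n})$, and let $Z$ be an $\mathbb{R}^n$-valued random vector with finite entropy $h(Z)$ and finite second moments, jointly distributed with $X$ so that $I(X;Z)\le \zeta<+\infty$. Then for every $\epsilon>0$ there is a coupling $(X',Z')$ of $X$ and $Z$ (that is, a pair of random vectors on a common probability space such that $X'$ has the law of $X$ and $Z'$ has the law of $Z$) with $$h(X'+Z')\ \ge\ h(X+Z)-\epsilon \qquad\text{and}\qquad I(X';Z')=\zeta .$$ -/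

import Mathlib

open MeasureTheory ProbabilityTheory
open scoped ENNReal NNReal

noncomputable section

open Classical in
/-- Shannon (differential) entropy `h(μ) = -∫ log (dμ/dx) dμ` in nats of a measure on a Euclidean
space, as an extended real: the integral of the positive part of `-log (dμ/dx)` minus the integral
of its negative part. It is `-∞` if `μ` is not absolutely continuous with respect to Lebesgue
measure (and, by the convention `⊤ - ⊤ = ⊥` in `EReal`, if the integral does not exist; this never
happens when `μ` is a probability measure with finite second moment). -/
def shannonEntropy {E : Type*} [MeasureSpace E] (μ : Measure E) : EReal :=
  if μ ≪ volume then
    ((∫⁻ x, ENNReal.ofReal (-Real.log (μ.rnDeriv volume x).toReal) ∂μ : ℝ≥0∞) : EReal)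
      - ((∫⁻ x, ENNReal.ofReal (Real.log (μ.rnDeriv volume x).toReal) ∂μ : ℝ≥0∞) : EReal)
  else ⊥

/-- The class `𝒫(E)` of probability measures on `E` with finite entropy and finite second
moments. -/
def finiteEntropyLaws (E : Type*) [NormedAddCommGroup E] [MeasureSpace E] : Set (Measure E) :=
  {μ | IsProbabilityMeasure μ ∧ MemLp (fun x : E => x) 2 μ ∧
    shannonEntropy μ ≠ ⊥ ∧ shannonEntropy μ ≠ ⊤}

/-- The set `Π(μ, ν)` of couplings: joint laws with first marginal `μ` and second marginal `ν`. -/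
def couplings {E F : Type*} [MeasurableSpace E] [MeasurableSpace F]
    (μ : Measure E) (ν : Measure F) : Set (Measure (E × F)) :=
  {π | π.fst = μ ∧ π.snd = ν}

/-- The mutual information `I(X;Z)` in nats of a pair `(X, Z)` with joint law `π`: the relative
entropy of the joint law with respect to the product of its marginals. -/
def mutualInformation {E F : Type*} [MeasurableSpace E] [MeasurableSpace F]
    (π : Measure (E × F)) : ℝ≥0∞ :=
  InformationTheory.klDiv π (π.fst.prod π.snd)

/-- The law of `X + Z` when `(X, Z)` has joint law `π`. -/
def sumLaw {E : Type*} [MeasurableSpace E] [Add E] (π : Measure (E × E)) : Measure E :=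
  π.map (fun p => p.1 + p.2)

end

/-!
All couplings of two given laws have the same marginals, so mutual information restricted to them is
the relative entropy with respect to one fixed product measure. The coupling sought is a mixture
`(1 - δ) π + δ σ` of the given coupling `π` with an auxiliary coupling `σ` of large information,
where `δ` is small.

*The auxiliary coupling.* The laws of the first coordinates of `X` and of `Z` have no atoms, so
both can be cut into `k` consecutive intervals of mass `1 / k`. Under `σ` (`blockCoupling`) a common
index is drawn uniformly, and then `X` and `Z` are drawn independently in the corresponding slabs.
The density of `σ` with respect to the product of the marginals is `k` on a set of mass `1 / k`, so
its information `log k` is as large as desired. On the other hand, since the slabs are ordered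
increasingly on both sides, each value of `X + Z` is attained in only one pair of slabs, and the
density of `X + Z` under `σ` is bounded by the maximum of the Gaussian density, which is at most `1`
(`sumLaw_blockCoupling_le`). This bound does not depend on `k`.

*The entropy.* As `t ↦ -t log t` is concave, and nonnegative on `[0, 1]`, the entropy of the sum
under the mixture is at least `(1 - δ)` times that under `π`. This fixes a threshold `δ₀` for `δ`,
before `k` is chosen (`exists_forall_shannonEntropy_mixture_ge`).

*The information.* The information of the mixture is a continuous function of `δ`. It is at most `ζ`
for `δ = 0`, and at least `δ₀ log (δ₀ k) - δ₀` for `δ = δ₀`, hence at least `ζ` if `k` is large. By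
the intermediate value theorem it equals `ζ` for some `δ ≤ δ₀` (`exists_klDiv_mixture_eq`).
-/

/-! ### Cells of equal mass on the real line -/

theorem continuous_cdf_of_measure_singleton_eq_zero (ν : Measure ℝ) [IsProbabilityMeasure ν]
    (h : ∀ c, ν {c} = 0) : Continuous (cdf ν) := by
  refine continuous_iff_continuousAt.2 fun a => ?_
  rw [(monotone_cdf ν).continuousAt_iff_leftLim_eq_rightLim, StieltjesFunction.rightLim_eq]
  have h1 := (cdf ν).measure_singleton a
  rw [measure_cdf, h, eq_comm, ENNReal.ofReal_eq_zero] at h1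
  exact le_antisymm ((monotone_cdf ν).leftLim_le le_rfl) (by linarith)

theorem exists_cdf_eq (ν : Measure ℝ) [IsProbabilityMeasure ν]
    (h : ∀ c, ν {c} = 0) {c : ℝ} (hc0 : 0 < c) (hc1 : c < 1) : ∃ b, cdf ν b = c := by
  refine mem_range_of_exists_le_of_exists_ge
    (continuous_cdf_of_measure_singleton_eq_zero ν h) ?_ ?_
  · exact (((tendsto_cdf_atBot ν).eventually (gt_mem_nhds hc0)).exists).imp fun _ h => h.le
  · exact (((tendsto_cdf_atTop ν).eventually (lt_mem_nhds hc1)).exists).imp fun _ h => h.le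

/-- The probability integral transform: the distribution function of an atomless law, viewed as a
random variable under that law, is uniformly distributed on `[0, 1]`. -/
theorem measureReal_cdf_lt (ν : Measure ℝ) [IsProbabilityMeasure ν]
    (h : ∀ c, ν {c} = 0) {c : ℝ} (hc0 : 0 ≤ c) (hc1 : c ≤ 1) :
    ν.real {t | cdf ν t < c} = c := by
  refine le_antisymm ?_ (le_of_forall_lt fun d hd => ?_)
  · rcases hc0.eq_or_lt with rfl | hc0
    · simp [not_lt.2 (cdf_nonneg ν _)]
    rcases hc1.eq_or_lt with rfl | hc1
    · exact measureReal_le_one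
    obtain ⟨b, hb⟩ := exists_cdf_eq ν h hc0 hc1
    calc ν.real {t | cdf ν t < c} ≤ ν.real (Set.Iic b) := by
          refine measureReal_mono fun t ht => ?_
          exact ((monotone_cdf ν).reflect_lt (by simpa [hb] using ht)).le
      _ = c := by rw [← cdf_eq_real, hb]
  · rcases lt_or_ge d 0 with hd0 | hd0
    · exact hd0.trans_le measureReal_nonneg
    obtain ⟨e, hde, hec⟩ := exists_between hd
    obtain ⟨b, hb⟩ := exists_cdf_eq ν h (hd0.trans_lt hde) (hec.trans_le hc1)
    calc d < e := hde
      _ = ν.real (Set.Iic b) := by rw [← cdf_eq_real, hb]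
      _ ≤ _ := by
          refine measureReal_mono fun t ht => ?_
          exact (monotone_cdf ν ht).trans_lt (hb ▸ hec)

/-- An atomless law on the line is cut into `k` consecutive intervals of equal mass: the map `J`
sends a point to the index of its interval. -/
theorem exists_monotone_cells (ν : Measure ℝ) [IsProbabilityMeasure ν]
    (h : ∀ c, ν {c} = 0) {k : ℕ} (hk : 0 < k) :
    ∃ J : ℝ → ℕ, Monotone J ∧ ∀ j < k, ν {t | J t = j} = (k : ℝ≥0∞)⁻¹ := by
  have hk' : (0 : ℝ) < k := by exact_mod_cast hk
  refine ⟨fun t => ⌊k * cdf ν t⌋₊, fun s t hst => ?_, fun j hj => ?_⟩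
  · exact Nat.floor_mono (mul_le_mul_of_nonneg_left (monotone_cdf ν hst) hk'.le)
  have hj' : (j : ℝ) + 1 ≤ k := by exact_mod_cast hj
  have hset : {t | ⌊k * cdf ν t⌋₊ = j} =
      {t | cdf ν t < (j + 1) / k} \ {t | cdf ν t < j / k} := by
    ext t
    simp only [Set.mem_ofPred_eq, Set.mem_sdiff, not_lt]
    rw [Nat.floor_eq_iff (mul_nonneg hk'.le (cdf_nonneg ν t)), lt_div_iff₀ hk', div_le_iff₀ hk',
      mul_comm, and_comm]
  have hm : ∀ c, MeasurableSet {t | cdf ν t < c} := fun c =>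
    measurableSet_lt (monotone_cdf ν).measurable measurable_const
  have hr : ν.real {t | ⌊k * cdf ν t⌋₊ = j} = (k : ℝ)⁻¹ := by
    rw [hset, measureReal_sdiff _ (hm _), measureReal_cdf_lt ν h (by positivity),
      measureReal_cdf_lt ν h (by positivity)]
    · field_simp; ring
    · rw [div_le_one hk']; linarith
    · rw [div_le_one hk']; linarith
    · intro t (ht : cdf ν t < j / k)
      exact ht.trans_le (by gcongr; linarith)
  rw [← ENNReal.ofReal_toReal (measure_ne_top ν _), ← measureReal_def, hr,
    ENNReal.ofReal_inv_of_pos hk', ENNReal.ofReal_natCast]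

/-! ### Block couplings -/

section BlockCoupling

variable {α β : Type*} [MeasurableSpace α] [MeasurableSpace β]

/-- The pairs lying in cells with the same index. -/
def matchingCells (J : α → ℕ) (L : β → ℕ) : Set (α × β) := {p | J p.1 = L p.2}

/-- The measure with density `k` with respect to `μ.prod ν` on the pairs with matching cells. If the
cells of index `j < k` all have mass `1 / k` under both `μ` and `ν`, it is the joint law obtained by
drawing a common index uniformly, and then two independent points in the corresponding cells. -/
noncomputable def blockCoupling (μ : Measure α) (ν : Measure β) (k : ℕ) (J : α → ℕ) (L : β → ℕ) :
    Measure (α × β) :=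
  (μ.prod ν).withDensity ((matchingCells J L).indicator fun _ => (k : ℝ≥0∞))

theorem measurableSet_matchingCells {J : α → ℕ} {L : β → ℕ} (hJ : Measurable J)
    (hL : Measurable L) : MeasurableSet (matchingCells J L) :=
  measurableSet_eq_fun (hJ.comp measurable_fst) (hL.comp measurable_snd)

theorem ae_lt_of_measure_cells {μ : Measure α} [IsProbabilityMeasure μ] {k : ℕ} (hk : 0 < k)
    {J : α → ℕ} (hJ : Measurable J) (h : ∀ j < k, μ {x | J x = j} = (k : ℝ≥0∞)⁻¹) :
    ∀ᵐ x ∂μ, J x < k := by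
  have hm : MeasurableSet {x | J x < k} := hJ measurableSet_Iio
  refine (prob_compl_eq_zero_iff hm).2 ?_
  have hu : {x | J x < k} = ⋃ j ∈ Finset.range k, {x | J x = j} := by
    ext x; simp
  rw [hu, measure_biUnion_finset]
  · rw [Finset.sum_congr rfl fun j hj => h j (Finset.mem_range.1 hj)]
    simp [ENNReal.mul_inv_cancel, hk.ne']
  · intro i _ j _ hij
    exact Set.disjoint_left.2 fun x hi hj => hij (hi.symm.trans hj)
  · exact fun j _ => hJ (measurableSet_singleton j)

/-- Conditionally on one point, the density of the block coupling integrates to one; this is why its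
marginals are the given laws. -/
theorem lintegral_matchingCells_right {γ : Type*} {ν : Measure β} {k : ℕ} (hk : 0 < k)
    {L : β → ℕ} (hL : Measurable L) (h : ∀ j < k, ν {z | L z = j} = (k : ℝ≥0∞)⁻¹)
    {J : γ → ℕ} {x : γ} (hx : J x < k) :
    ∫⁻ z, (matchingCells J L).indicator (fun _ => (k : ℝ≥0∞)) (x, z) ∂ν = 1 := by
  have : ∀ z, (matchingCells J L).indicator (fun _ => (k : ℝ≥0∞)) (x, z) =
      {z | L z = J x}.indicator (fun _ => (k : ℝ≥0∞)) z := fun z => by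
    simp [Set.indicator_apply, matchingCells, eq_comm]
  simp_rw [this]
  rw [lintegral_indicator_const (s := {z | L z = J x}) (hL (measurableSet_singleton (J x))), h _ hx]
  exact ENNReal.mul_inv_cancel (by simpa using hk.ne') (by simp)

theorem fst_blockCoupling {μ : Measure α} {ν : Measure β} [IsProbabilityMeasure μ]
    [IsProbabilityMeasure ν] {k : ℕ} (hk : 0 < k) {J : α → ℕ} {L : β → ℕ}
    (hJ : Measurable J) (hL : Measurable L)
    (hμ : ∀ j < k, μ {x | J x = j} = (k : ℝ≥0∞)⁻¹)
    (hν : ∀ j < k, ν {z | L z = j} = (k : ℝ≥0∞)⁻¹) :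
    (blockCoupling μ ν k J L).fst = μ := by
  have hd : Measurable ((matchingCells J L).indicator fun _ => (k : ℝ≥0∞)) :=
    measurable_const.indicator (measurableSet_matchingCells hJ hL)
  ext A hA
  rw [Measure.fst_apply hA, blockCoupling, withDensity_apply _ (measurable_fst hA),
    ← lintegral_indicator (measurable_fst hA),
    lintegral_prod _ (hd.indicator (measurable_fst hA)).aemeasurable,
    ← lintegral_indicator_one hA]
  refine lintegral_congr_ae ?_
  filter_upwards [ae_lt_of_measure_cells hk hJ hμ] with x hx
  by_cases hxA : x ∈ A
  · simpa [Set.indicator_apply, hxA] using lintegral_matchingCells_right hk hL hν hx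
  · simp [hxA]

theorem snd_blockCoupling {μ : Measure α} {ν : Measure β} [IsProbabilityMeasure μ]
    [IsProbabilityMeasure ν] {k : ℕ} (hk : 0 < k) {J : α → ℕ} {L : β → ℕ}
    (hJ : Measurable J) (hL : Measurable L)
    (hμ : ∀ j < k, μ {x | J x = j} = (k : ℝ≥0∞)⁻¹)
    (hν : ∀ j < k, ν {z | L z = j} = (k : ℝ≥0∞)⁻¹) :
    (blockCoupling μ ν k J L).snd = ν := by
  have hd : Measurable ((matchingCells J L).indicator fun _ => (k : ℝ≥0∞)) :=
    measurable_const.indicator (measurableSet_matchingCells hJ hL)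
  ext A hA
  rw [Measure.snd_apply hA, blockCoupling, withDensity_apply _ (measurable_snd hA),
    ← lintegral_indicator (measurable_snd hA),
    lintegral_prod_symm _ (hd.indicator (measurable_snd hA)).aemeasurable,
    ← lintegral_indicator_one hA]
  refine lintegral_congr_ae ?_
  filter_upwards [ae_lt_of_measure_cells hk hL hν] with z hz
  by_cases hzA : z ∈ A
  · have hs : ∀ x, (matchingCells J L).indicator (fun _ => (k : ℝ≥0∞)) (x, z) =
        (matchingCells L J).indicator (fun _ => (k : ℝ≥0∞)) (z, x) := fun x => by
      simp [Set.indicator_apply, matchingCells, eq_comm]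
    have := lintegral_matchingCells_right hk hJ hμ hz
    simp_rw [← hs] at this
    simpa [Set.indicator_apply, hzA] using this
  · simp [hzA]

theorem prod_matchingCells {μ : Measure α} {ν : Measure β} [IsProbabilityMeasure μ]
    [IsProbabilityMeasure ν] {k : ℕ} (hk : 0 < k) {J : α → ℕ} {L : β → ℕ}
    (hJ : Measurable J) (hL : Measurable L)
    (hμ : ∀ j < k, μ {x | J x = j} = (k : ℝ≥0∞)⁻¹)
    (hν : ∀ j < k, ν {z | L z = j} = (k : ℝ≥0∞)⁻¹) :
    (μ.prod ν) (matchingCells J L) = (k : ℝ≥0∞)⁻¹ := by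
  rw [Measure.prod_apply (measurableSet_matchingCells hJ hL)]
  calc _ = ∫⁻ _, (k : ℝ≥0∞)⁻¹ ∂μ := by
        refine lintegral_congr_ae ?_
        filter_upwards [ae_lt_of_measure_cells hk hJ hμ] with x hx
        rw [← hν _ hx]
        congr 1; ext z; simp [matchingCells, eq_comm]
    _ = _ := by simp

end BlockCoupling

/-- Two increasing families of cells make the sum spread out: a given value `s = x + z` can be
attained within a single pair of matching cells only, because along `x + z = s` the index of the
cell of `x` decreases while that of `z` increases. Hence, if `X` has a density bounded by `1`, then
so does `X + Z` under the block coupling, whatever the number of cells. -/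
theorem sumLaw_blockCoupling_le {E : Type*} [NormedAddCommGroup E] [MeasureSpace E] [BorelSpace E]
    [SecondCountableTopology E] [SFinite (volume : Measure E)]
    [(volume : Measure E).IsAddRightInvariant]
    {μ ν : Measure E} [IsProbabilityMeasure ν] (hμ : μ ≤ volume) {k : ℕ} (hk : 0 < k)
    {u : E →+ ℝ} (hu : Measurable u) {J L : ℝ → ℕ} (hJ : Monotone J) (hL : Monotone L)
    (hν : ∀ j < k, ν {z | L (u z) = j} = (k : ℝ≥0∞)⁻¹) :
    sumLaw (blockCoupling μ ν k (J ∘ u) (L ∘ u)) ≤ volume := by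
  have hLu : Measurable (L ∘ u) := hL.measurable.comp hu
  set d : E × E → ℝ≥0∞ := (matchingCells (J ∘ u) (L ∘ u)).indicator fun _ => (k : ℝ≥0∞) with hd_def
  have hd : Measurable d := measurable_const.indicator
    (measurableSet_matchingCells (hJ.measurable.comp hu) hLu)
  have hadd : Measurable fun p : E × E => p.1 + p.2 := measurable_fst.add measurable_snd
  have hds : ∀ s, Measurable fun z => d (s - z, z) := fun s =>
    hd.comp ((measurable_const.sub measurable_id).prodMk measurable_id)
  -- All `z` that contribute to the integral lie in the cell of any one of them, `z₀`.
  have hcell : ∀ s, ∫⁻ z, d (s - z, z) ∂ν ≤ 1 := by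
    intro s
    by_cases hne : ∃ z₀, L (u z₀) < k ∧ J (u (s - z₀)) = L (u z₀)
    · obtain ⟨z₀, hz₀, hJz₀⟩ := hne
      calc ∫⁻ z, d (s - z, z) ∂ν ≤ ∫⁻ z, {z | L (u z) = L (u z₀)}.indicator
              (fun _ => (k : ℝ≥0∞)) z ∂ν := by
            refine lintegral_mono fun z => ?_
            by_cases hz : J (u (s - z)) = L (u z)
            · have : L (u z) = L (u z₀) := by
                rw [map_sub] at hz hJz₀
                rcases le_total (u z) (u z₀) with h | h
                · refine le_antisymm (hL h) ?_
                  rw [← hz, ← hJz₀]; exact hJ (by linarith)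
                · refine le_antisymm ?_ (hL h)
                  rw [← hz, ← hJz₀]; exact hJ (by linarith)
              rw [Set.indicator_of_mem (s := {z | L (u z) = L (u z₀)}) this]
              exact Set.indicator_le_self' (fun _ _ => zero_le) _
            · have hz' : (s - z, z) ∉ matchingCells (J ∘ u) (L ∘ u) := hz
              simp [hd_def, hz']
        _ = 1 := by
            rw [lintegral_indicator_const (s := {z | L (u z) = L (u z₀)})
              (hLu (measurableSet_singleton (L (u z₀)))), hν _ hz₀]
            exact ENNReal.mul_inv_cancel (by simpa using hk.ne') (by simp)
    · push Not at hne
      have : ∫⁻ z, d (s - z, z) ∂ν = 0 := by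
        rw [lintegral_eq_zero_iff (hds s)]
        filter_upwards [ae_lt_of_measure_cells hk hLu hν] with z hz
        have hz' : (s - z, z) ∉ matchingCells (J ∘ u) (L ∘ u) := hne z hz
        simp [hd_def, hz']
      simp [this]
  refine Measure.le_iff.2 fun A hA => ?_
  have hA' : Measurable (A.indicator (1 : E → ℝ≥0∞)) := measurable_one.indicator hA
  have hf : Measurable fun p : E × E => d p * A.indicator 1 (p.1 + p.2) := hd.mul (hA'.comp hadd)
  calc sumLaw (blockCoupling μ ν k (J ∘ u) (L ∘ u)) A
      = ∫⁻ p, d p * A.indicator 1 (p.1 + p.2) ∂(μ.prod ν) := by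
        rw [sumLaw, Measure.map_apply hadd hA, blockCoupling, withDensity_apply _ (hadd hA),
          ← lintegral_indicator (hadd hA)]
        refine lintegral_congr fun p => ?_
        by_cases hp : p.1 + p.2 ∈ A <;> simp [hp, hd_def]
    _ ≤ ∫⁻ p, d p * A.indicator 1 (p.1 + p.2) ∂(volume.prod ν) :=
        lintegral_mono' (Measure.prod_mono hμ le_rfl) le_rfl
    _ = ∫⁻ z, ∫⁻ x, d (x, z) * A.indicator 1 (x + z) ∂volume ∂ν :=
        lintegral_prod_symm _ hf.aemeasurable
    _ = ∫⁻ z, ∫⁻ s, d (s - z, z) * A.indicator 1 s ∂volume ∂ν := by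
        refine lintegral_congr fun z => ?_
        rw [← lintegral_sub_right_eq_self _ z]
        simp
    _ = ∫⁻ s, ∫⁻ z, d (s - z, z) * A.indicator 1 s ∂ν ∂volume := by
        refine lintegral_lintegral_swap (Measurable.aemeasurable ?_)
        exact (hd.comp ((measurable_snd.sub measurable_fst).prodMk measurable_fst)).mul
          (hA'.comp measurable_snd)
    _ ≤ ∫⁻ s, A.indicator 1 s ∂volume := by
        refine lintegral_mono fun s => ?_
        rw [lintegral_mul_const _ (hds s)]
        exact mul_le_of_le_one_left' (hcell s)
    _ = volume A := lintegral_indicator_one hA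

/-! ### The standard Gaussian measure -/

theorem gaussianReal_zero_one_le_volume : gaussianReal 0 1 ≤ volume := by
  rw [gaussianReal_of_var_ne_zero 0 one_ne_zero]
  conv_rhs => rw [← withDensity_one (μ := (volume : Measure ℝ))]
  refine withDensity_mono (Filter.Eventually.of_forall fun x => ?_)
  rw [gaussianPDF, Pi.one_apply, ENNReal.ofReal_le_one, gaussianPDFReal]
  refine mul_le_one₀ (inv_le_one_of_one_le₀ ?_) (Real.exp_nonneg _) (Real.exp_le_one_iff.2 ?_)
  · rw [Real.one_le_sqrt]
    norm_num
    linarith [Real.pi_gt_three]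
  · have := sq_nonneg (x - 0)
    norm_num at this ⊢
    linarith

theorem Measure.pi_mono_of_le {ι : Type*} [Fintype ι] {α : ι → Type*} [∀ i, MeasurableSpace (α i)]
    {μ ν : ∀ i, Measure (α i)} [∀ i, SigmaFinite (ν i)] (h : ∀ i, μ i ≤ ν i) :
    Measure.pi μ ≤ Measure.pi ν := by
  refine Measure.le_iff.2 fun s hs => ?_
  rw [Measure.pi, Measure.pi, toMeasure_apply _ _ hs, toMeasure_apply _ _ hs]
  refine OuterMeasure.le_pi.2 (fun t _ => ?_) s
  exact (OuterMeasure.pi_pi_le _ t).trans (Finset.prod_le_prod' fun i _ => h i (t i))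

theorem stdGaussian_le_volume (ι : Type*) [Fintype ι] :
    stdGaussian (EuclideanSpace ℝ ι) ≤ volume := by
  rw [← map_pi_eq_stdGaussian, ← (PiLp.volume_preserving_toLp ι).map_eq]
  exact Measure.map_mono (Measure.pi_mono_of_le fun _ => gaussianReal_zero_one_le_volume)
    (PiLp.volume_preserving_toLp ι).measurable

theorem EuclideanSpace.volume_coord_eq {ι : Type*} [Fintype ι] (i : ι) (c : ℝ) :
    volume {x : EuclideanSpace ℝ ι | x i = c} = 0 := by
  have hm : MeasurableSet {x : EuclideanSpace ℝ ι | x i = c} :=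
    measurableSet_eq_fun (by fun_prop) measurable_const
  rw [← (PiLp.volume_preserving_toLp ι).measure_preimage hm.nullMeasurableSet]
  exact Measure.pi_hyperplane (fun _ : ι => (volume : Measure ℝ)) i c

/-! ### Mixtures -/

/-- The mixture `(1 - δ) μ + δ ν` of two measures, for `0 ≤ δ ≤ 1`. -/
noncomputable def mixture {α : Type*} [MeasurableSpace α] (δ : ℝ) (μ ν : Measure α) : Measure α :=
  ENNReal.ofReal (1 - δ) • μ + ENNReal.ofReal δ • ν

section Mixture

variable {α β : Type*} [MeasurableSpace α] [MeasurableSpace β]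

theorem ofReal_one_sub_add_ofReal {δ : ℝ} (h0 : 0 ≤ δ) (h1 : δ ≤ 1) :
    ENNReal.ofReal (1 - δ) + ENNReal.ofReal δ = 1 := by
  rw [← ENNReal.ofReal_add (sub_nonneg.2 h1) h0]
  simp

theorem mixture_self {δ : ℝ} (h0 : 0 ≤ δ) (h1 : δ ≤ 1) (μ : Measure α) : mixture δ μ μ = μ := by
  rw [mixture, ← add_smul, ofReal_one_sub_add_ofReal h0 h1, one_smul]

theorem map_mixture (δ : ℝ) (μ ν : Measure α) {f : α → β} (hf : Measurable f) :
    (mixture δ μ ν).map f = mixture δ (μ.map f) (ν.map f) := by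
  rw [mixture, mixture, Measure.map_add _ _ hf, Measure.map_smul, Measure.map_smul]

theorem mixture_mem_couplings {δ : ℝ} (h0 : 0 ≤ δ) (h1 : δ ≤ 1) {μ : Measure α} {ν : Measure β}
    {π σ : Measure (α × β)} (hπ : π ∈ couplings μ ν) (hσ : σ ∈ couplings μ ν) :
    mixture δ π σ ∈ couplings μ ν := by
  constructor
  · rw [Measure.fst, map_mixture _ _ _ measurable_fst]
    exact (congrArg₂ (mixture δ) hπ.1 hσ.1).trans (mixture_self h0 h1 μ)
  · rw [Measure.snd, map_mixture _ _ _ measurable_snd]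
    exact (congrArg₂ (mixture δ) hπ.2 hσ.2).trans (mixture_self h0 h1 ν)

theorem mixture_withDensity (δ : ℝ) (h0 : 0 ≤ δ) (h1 : δ ≤ 1) (ρ : Measure α) {p q : α → ℝ}
    (hp : Measurable p) (hq : Measurable q) (hp0 : ∀ x, 0 ≤ p x) (hq0 : ∀ x, 0 ≤ q x) :
    mixture δ (ρ.withDensity fun x => ENNReal.ofReal (p x))
      (ρ.withDensity fun x => ENNReal.ofReal (q x)) =
    ρ.withDensity fun x => ENNReal.ofReal ((1 - δ) * p x + δ * q x) := by
  rw [mixture, ← withDensity_smul _ (by fun_prop), ← withDensity_smul _ (by fun_prop),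
    ← withDensity_add_left (by fun_prop)]
  congr 1
  ext x
  simp only [Pi.add_apply, Pi.smul_apply, smul_eq_mul]
  rw [ENNReal.ofReal_add (mul_nonneg (sub_nonneg.2 h1) (hp0 x)) (mul_nonneg h0 (hq0 x)),
    ENNReal.ofReal_mul (sub_nonneg.2 h1), ENNReal.ofReal_mul h0]

end Mixture

/-! ### Relative entropy along a mixture -/

open InformationTheory

section RelativeEntropy

variable {α : Type*} [MeasurableSpace α]

theorem withDensity_ofReal_toReal_rnDeriv {π ρ : Measure α} [SigmaFinite π] [SigmaFinite ρ]
    (h : π ≪ ρ) : ρ.withDensity (fun x => ENNReal.ofReal (π.rnDeriv ρ x).toReal) = π := by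
  conv_rhs => rw [← Measure.withDensity_rnDeriv_eq π ρ h]
  refine withDensity_congr_ae ?_
  filter_upwards [Measure.rnDeriv_ne_top π ρ] with x hx
  exact ENNReal.ofReal_toReal hx

theorem klDiv_withDensity_ofReal {ρ : Measure α} [IsFiniteMeasure ρ] {f : α → ℝ}
    (hf : Measurable f) (hf0 : ∀ x, 0 ≤ f x) (hint : Integrable f ρ)
    (hkl : Integrable (fun x => klFun (f x)) ρ) :
    klDiv (ρ.withDensity fun x => ENNReal.ofReal (f x)) ρ =
      ENNReal.ofReal (∫ x, klFun (f x) ∂ρ) := by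
  have : IsFiniteMeasure (ρ.withDensity fun x => ENNReal.ofReal (f x)) :=
    isFiniteMeasure_withDensity_ofReal hint.2
  rw [klDiv_eq_lintegral_klFun_of_ac (withDensity_absolutelyContinuous _ _),
    ofReal_integral_eq_lintegral_ofReal hkl
      (Filter.Eventually.of_forall fun x => klFun_nonneg (hf0 x))]
  refine lintegral_congr_ae ?_
  filter_upwards [Measure.rnDeriv_withDensity ρ hf.ennreal_ofReal] with x hx
  rw [hx, ENNReal.toReal_ofReal (hf0 x)]

theorem klFun_convexComb_le {δ s t : ℝ} (h0 : 0 ≤ δ) (h1 : δ ≤ 1) (hs : 0 ≤ s) (ht : 0 ≤ t) :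
    klFun ((1 - δ) * s + δ * t) ≤ klFun s + klFun t := by
  have h := convexOn_klFun.2 (x := s) (y := t) hs ht (sub_nonneg.2 h1) h0 (by ring)
  simp only [smul_eq_mul] at h
  nlinarith [klFun_nonneg hs, klFun_nonneg ht]

theorem klFun_mono {s t : ℝ} (hs : 1 ≤ s) (hst : s ≤ t) : klFun s ≤ klFun t := by
  have h : klFun s ≤ max (klFun 1) (klFun t) :=
    convexOn_klFun.le_max_of_mem_Icc (by simp) (by simp; linarith) ⟨hs, hst⟩
  rwa [klFun_one, max_eq_right (klFun_nonneg (by linarith))] at h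

/-- Mixing in a small amount `δ ≤ δ₀` of a law `σ` which has constant density `k` on a set `D` of
mass `1 / k` brings the relative entropy up to any prescribed value `ζ`, once `k` is so large that
the mass `δ₀` placed on `D` by itself costs `δ₀ * log (δ₀ * k) - δ₀ ≥ ζ`. The relative entropy
depends continuously on `δ`, so that the intermediate value theorem applies. -/
theorem exists_klDiv_mixture_eq {π ρ : Measure α} [IsProbabilityMeasure π] [IsProbabilityMeasure ρ]
    {ζ : ℝ≥0} (hπ : klDiv π ρ ≤ ζ) {D : Set α} (hD : MeasurableSet D) {k : ℕ} (hk : 0 < k)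
    (hDk : ρ D = (k : ℝ≥0∞)⁻¹) {δ₀ : ℝ} (h0 : 0 ≤ δ₀) (h1 : δ₀ ≤ 1) (hδk : 1 ≤ δ₀ * k)
    (hζ : ζ ≤ δ₀ * Real.log (δ₀ * k) - δ₀) :
    ∃ δ ∈ Set.Icc 0 δ₀,
      klDiv (mixture δ π (ρ.withDensity (D.indicator fun _ => (k : ℝ≥0∞)))) ρ = ζ := by
  obtain ⟨hac, hllr⟩ := klDiv_ne_top_iff.1 (hπ.trans_lt ENNReal.coe_lt_top).ne
  set p : α → ℝ := fun x => (π.rnDeriv ρ x).toReal with hp_def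
  set q : α → ℝ := D.indicator fun _ => (k : ℝ) with hq_def
  have hp : Measurable p := (Measure.measurable_rnDeriv π ρ).ennreal_toReal
  have hq : Measurable q := measurable_const.indicator hD
  have hp0 : ∀ x, 0 ≤ p x := fun x => ENNReal.toReal_nonneg
  have hq0 : ∀ x, 0 ≤ q x := fun x => Set.indicator_nonneg (fun _ _ => Nat.cast_nonneg k) x
  have hpi : Integrable p ρ := Measure.integrable_toReal_rnDeriv
  have hqi : Integrable q ρ := (integrable_const _).indicator hD
  have hklp : Integrable (fun x => klFun (p x)) ρ := (integrable_klFun_rnDeriv_iff hac).2 hllr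
  have hklq : Integrable (fun x => klFun (q x)) ρ := by
    have : (fun x => klFun (q x)) = fun x => D.indicator (fun _ => klFun k) x
        + Dᶜ.indicator (fun _ => 1) x := by
      ext x
      by_cases hx : x ∈ D <;> simp [hq_def, hx, klFun_zero]
    rw [this]
    exact ((integrable_const _).indicator hD).add ((integrable_const _).indicator hD.compl)
  have hσ : ρ.withDensity (D.indicator fun _ => (k : ℝ≥0∞)) =
      ρ.withDensity fun x => ENNReal.ofReal (q x) := by
    congr 1
    ext x
    by_cases hx : x ∈ D <;> simp [hq_def, hx]
  let f : ℝ → α → ℝ := fun δ x => (1 - δ) * p x + δ * q x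
  have hf : ∀ δ, Measurable (f δ) := fun δ => (hp.const_mul _).add (hq.const_mul _)
  have hf0 : ∀ δ ∈ Set.Icc 0 δ₀, ∀ x, 0 ≤ f δ x := fun δ hδ x =>
    add_nonneg (mul_nonneg (sub_nonneg.2 (hδ.2.trans h1)) (hp0 x)) (mul_nonneg hδ.1 (hq0 x))
  have hbound : ∀ δ ∈ Set.Icc 0 δ₀, ∀ᵐ x ∂ρ, ‖klFun (f δ x)‖ ≤ klFun (p x) + klFun (q x) :=
    fun δ hδ => Filter.Eventually.of_forall fun x => by
      rw [Real.norm_of_nonneg (klFun_nonneg (hf0 δ hδ x))]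
      exact klFun_convexComb_le hδ.1 (hδ.2.trans h1) (hp0 x) (hq0 x)
  have hmeas : ∀ δ, AEStronglyMeasurable (fun x => klFun (f δ x)) ρ := fun δ =>
    (measurable_klFun.comp (hf δ)).aestronglyMeasurable
  have hint : ∀ δ ∈ Set.Icc 0 δ₀, Integrable (fun x => klFun (f δ x)) ρ := fun δ hδ =>
    (hklp.add hklq).mono' (hmeas δ) (hbound δ hδ)
  have hkl : ∀ δ ∈ Set.Icc 0 δ₀,
      klDiv (mixture δ π (ρ.withDensity (D.indicator fun _ => (k : ℝ≥0∞)))) ρ =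
        ENNReal.ofReal (∫ x, klFun (f δ x) ∂ρ) := fun δ hδ => by
    rw [hσ, ← withDensity_ofReal_toReal_rnDeriv hac,
      mixture_withDensity δ hδ.1 (hδ.2.trans h1) ρ hp hq hp0 hq0]
    exact klDiv_withDensity_ofReal (hf δ) (hf0 δ hδ)
      ((hpi.const_mul _).add (hqi.const_mul _)) (hint δ hδ)
  have hcont : ContinuousOn (fun δ => ∫ x, klFun (f δ x) ∂ρ) (Set.Icc 0 δ₀) := by
    refine continuousOn_of_dominated (fun δ _ => hmeas δ) hbound (hklp.add hklq)
      (Filter.Eventually.of_forall fun x => Continuous.continuousOn ?_)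
    exact continuous_klFun.comp (by fun_prop)
  -- At `δ = 0` the mixture is `π`.
  have hstart : ∫ x, klFun (f 0 x) ∂ρ ≤ ζ := by
    have h := hkl 0 ⟨le_rfl, h0⟩
    rw [mixture] at h
    simp only [sub_zero, ENNReal.ofReal_one, one_smul, ENNReal.ofReal_zero, zero_smul,
      add_zero] at h
    rw [h] at hπ
    rwa [← ENNReal.ofReal_coe_nnreal, ENNReal.ofReal_le_ofReal_iff ζ.coe_nonneg] at hπ
  -- At `δ = δ₀` the density is at least `δ₀ * k ≥ 1` on `D`, and `klFun` is increasing there.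
  have hend : (ζ : ℝ) ≤ ∫ x, klFun (f δ₀ x) ∂ρ := by
    have hk' : (0 : ℝ) < k := by exact_mod_cast hk
    have hDr : ρ.real D = (k : ℝ)⁻¹ := by simp [measureReal_def, hDk]
    calc (ζ : ℝ) ≤ δ₀ * Real.log (δ₀ * k) - δ₀ + (k : ℝ)⁻¹ := by
          have : 0 ≤ (k : ℝ)⁻¹ := by positivity
          linarith
      _ = ρ.real D * klFun (δ₀ * k) := by
          rw [hDr, klFun_apply]; field_simp; ring
      _ = ∫ x, D.indicator (fun _ => klFun (δ₀ * k)) x ∂ρ := by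
          rw [integral_indicator_const _ hD, smul_eq_mul]
      _ ≤ ∫ x, klFun (f δ₀ x) ∂ρ := by
          refine integral_mono ((integrable_const _).indicator hD) (hint δ₀ ⟨h0, le_rfl⟩) fun x => ?_
          by_cases hx : x ∈ D
          · simp only [Set.indicator_of_mem hx]
            refine klFun_mono hδk ?_
            have := mul_nonneg (sub_nonneg.2 h1) (hp0 x)
            simp only [f, hq_def, Set.indicator_of_mem hx]
            linarith
          · simp only [Set.indicator_of_notMem hx]
            exact klFun_nonneg (hf0 δ₀ ⟨h0, le_rfl⟩ x)
  obtain ⟨δ, hδ, hδζ⟩ := intermediate_value_Icc h0 hcont ⟨hstart, hend⟩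
  refine ⟨δ, hδ, ?_⟩
  rw [hkl δ hδ]
  simp only at hδζ
  rw [hδζ, ENNReal.ofReal_coe_nnreal]

end RelativeEntropy

/-! ### Entropy of a mixture with a law of bounded density -/

theorem EReal.sub_sub_le_mul_sub_mul {P N : ℝ≥0∞} (hN : N ≠ ⊤) {δ ε : ℝ} (h0 : 0 ≤ δ) (h1 : δ < 1)
    (hε : δ * P.toReal ≤ ε) :
    (P : EReal) - N - ε ≤
      (ENNReal.ofReal (1 - δ) * P : ℝ≥0∞) - (ENNReal.ofReal (1 - δ) * N : ℝ≥0∞) := by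
  have hc : 0 < 1 - δ := by linarith
  lift N to ℝ≥0 using hN
  by_cases hP : P = ⊤
  · have h3 : ENNReal.ofReal (1 - δ) ≠ 0 := by simpa using h1
    rw [hP, ENNReal.mul_top h3, EReal.coe_ennreal_top, ENNReal.ofReal, ← ENNReal.coe_mul,
      EReal.coe_nnreal_eq_coe_real (Real.toNNReal (1 - δ) * N), EReal.top_sub_coe]
    exact le_top
  · lift P to ℝ≥0 using hP
    rw [ENNReal.ofReal, ← ENNReal.coe_mul, ← ENNReal.coe_mul]
    simp only [EReal.coe_nnreal_eq_coe_real, ← EReal.coe_sub, EReal.coe_le_coe_iff,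
      NNReal.coe_mul, Real.coe_toNNReal _ hc.le]
    rw [ENNReal.coe_toReal] at hε
    nlinarith [mul_nonneg h0 N.2]

section Entropy

variable {E : Type*} [MeasureSpace E] [SigmaFinite (volume : Measure E)]

/-- Both parts of the entropy integral, written with respect to Lebesgue measure. -/
theorem shannonEntropy_of_absolutelyContinuous {μ : Measure E} [SigmaFinite μ]
    (h : μ ≪ volume) :
    shannonEntropy μ =
      ((∫⁻ x, ENNReal.ofReal (Real.negMulLog (μ.rnDeriv volume x).toReal) : ℝ≥0∞) : EReal)
      - ((∫⁻ x, ENNReal.ofReal (-Real.negMulLog (μ.rnDeriv volume x).toReal) : ℝ≥0∞) : EReal) := by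
  have hm : Measurable fun x => Real.log (μ.rnDeriv volume x).toReal :=
    (Measure.measurable_rnDeriv μ volume).ennreal_toReal.log
  have key : ∀ g : E → ℝ, Measurable g → ∫⁻ x, ENNReal.ofReal (g x) ∂μ =
      ∫⁻ x, ENNReal.ofReal ((μ.rnDeriv volume x).toReal * g x) := fun g hg => by
    rw [← lintegral_rnDeriv_mul h hg.ennreal_ofReal.aemeasurable]
    refine lintegral_congr_ae ?_
    filter_upwards [Measure.rnDeriv_ne_top μ volume] with x hx
    rw [ENNReal.ofReal_mul ENNReal.toReal_nonneg, ENNReal.ofReal_toReal hx]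
  rw [shannonEntropy, if_pos h, key (fun x => -Real.log (μ.rnDeriv volume x).toReal) hm.neg,
    key _ hm]
  simp [Real.negMulLog]

theorem toReal_rnDeriv_mixture {δ : ℝ} (h0 : 0 ≤ δ) (h1 : δ ≤ 1) (μ ν : Measure E)
    [IsFiniteMeasure μ] [IsFiniteMeasure ν] :
    ∀ᵐ x : E, ((mixture δ μ ν).rnDeriv volume x).toReal =
      (1 - δ) * (μ.rnDeriv volume x).toReal + δ * (ν.rnDeriv volume x).toReal := by
  have : IsFiniteMeasure (ENNReal.ofReal (1 - δ) • μ) := μ.smul_finite ENNReal.ofReal_ne_top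
  have : IsFiniteMeasure (ENNReal.ofReal δ • ν) := ν.smul_finite ENNReal.ofReal_ne_top
  filter_upwards [Measure.rnDeriv_add (ENNReal.ofReal (1 - δ) • μ) (ENNReal.ofReal δ • ν) volume,
    Measure.rnDeriv_smul_left_of_ne_top μ volume (r := ENNReal.ofReal (1 - δ))
      ENNReal.ofReal_ne_top,
    Measure.rnDeriv_smul_left_of_ne_top ν volume (r := ENNReal.ofReal δ) ENNReal.ofReal_ne_top,
    Measure.rnDeriv_ne_top μ volume, Measure.rnDeriv_ne_top ν volume] with x h2 h3 h4 h5 h6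
  rw [mixture, h2, Pi.add_apply, h3, h4]
  simp only [Pi.smul_apply, smul_eq_mul]
  rw [ENNReal.toReal_add (ENNReal.mul_ne_top ENNReal.ofReal_ne_top h5)
    (ENNReal.mul_ne_top ENNReal.ofReal_ne_top h6), ENNReal.toReal_mul, ENNReal.toReal_mul,
    ENNReal.toReal_ofReal (sub_nonneg.2 h1), ENNReal.toReal_ofReal h0]

/-- Concavity of `t ↦ -t log t`, together with its nonnegativity on `[0, 1]`: adding a law of
density at most `1` costs nothing but the factor `1 - δ`. -/
theorem mul_negMulLog_le_negMulLog_mixture {δ : ℝ} (h0 : 0 ≤ δ) (h1 : δ ≤ 1) {μ ν : Measure E}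
    [IsFiniteMeasure μ] [IsFiniteMeasure ν] (hν : ν ≤ volume) :
    ∀ᵐ x : E, (1 - δ) * Real.negMulLog (μ.rnDeriv volume x).toReal ≤
      Real.negMulLog ((mixture δ μ ν).rnDeriv volume x).toReal := by
  filter_upwards [toReal_rnDeriv_mixture h0 h1 μ ν, Measure.rnDeriv_le_one_of_le hν] with x hx hx1
  rw [hx]
  have hν1 : (ν.rnDeriv volume x).toReal ≤ 1 :=
    ENNReal.toReal_le_of_le_ofReal zero_le_one (by simpa using hx1)
  have hc := Real.concaveOn_negMulLog.2 (x := (μ.rnDeriv volume x).toReal)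
    (y := (ν.rnDeriv volume x).toReal) ENNReal.toReal_nonneg ENNReal.toReal_nonneg
    (sub_nonneg.2 h1) h0 (by ring)
  simp only [smul_eq_mul] at hc
  have := mul_nonneg h0 (Real.negMulLog_nonneg ENNReal.toReal_nonneg hν1)
  linarith

/-- Mixing in a sufficiently small amount of an arbitrary law with density at most `1` decreases
the entropy by at most `ε`; how small depends on the original law only. -/
theorem exists_forall_shannonEntropy_mixture_ge (μ : Measure E) [IsFiniteMeasure μ] {ε : ℝ}
    (hε : 0 < ε) :
    ∃ δ₀ : ℝ, 0 < δ₀ ∧ δ₀ ≤ 1 ∧ ∀ δ ∈ Set.Icc 0 δ₀, ∀ (ν : Measure E) [IsFiniteMeasure ν],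
      ν ≤ volume → shannonEntropy μ - (ε : EReal) ≤ shannonEntropy (mixture δ μ ν) := by
  -- Without a density, or if the negative part diverges, the entropy of `μ` is `⊥`.
  by_cases hac : μ ≪ volume
  swap
  · refine ⟨1, one_pos, le_rfl, fun δ _ ν _ _ => ?_⟩
    simp [shannonEntropy, hac]
  rw [shannonEntropy_of_absolutelyContinuous hac]
  set P := ∫⁻ x, ENNReal.ofReal (Real.negMulLog (μ.rnDeriv volume x).toReal)
  set N := ∫⁻ x, ENNReal.ofReal (-Real.negMulLog (μ.rnDeriv volume x).toReal)
  by_cases hN : N = ⊤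
  · refine ⟨1, one_pos, le_rfl, fun δ _ ν _ _ => ?_⟩
    simp [hN]
  -- If `P` is finite, the loss is at most `δ * P`. The bound `1 / 2` keeps `1 - δ` positive, which
  -- preserves `P = ⊤`.
  refine ⟨min (1 / 2) (ε / (1 + P.toReal)), by positivity, (min_le_left _ _).trans (by norm_num),
    fun δ hδ ν _ hν => ?_⟩
  have hδ0 : 0 ≤ δ := hδ.1
  have hδ2 : δ ≤ 1 / 2 := hδ.2.trans (min_le_left _ _)
  have hδ1 : δ ≤ 1 := by linarith
  have hδε : δ * (1 + P.toReal) ≤ ε :=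
    (le_div_iff₀ (by positivity)).1 (hδ.2.trans (min_le_right _ _))
  have hfin : IsFiniteMeasure (mixture δ μ ν) := by
    have : IsFiniteMeasure (ENNReal.ofReal (1 - δ) • μ) := μ.smul_finite ENNReal.ofReal_ne_top
    have : IsFiniteMeasure (ENNReal.ofReal δ • ν) := ν.smul_finite ENNReal.ofReal_ne_top
    unfold mixture
    infer_instance
  have hacm : mixture δ μ ν ≪ volume :=
    (hac.smul_left _).add_left ((Measure.absolutelyContinuous_of_le hν).smul_left _)
  have hle := mul_negMulLog_le_negMulLog_mixture hδ0 hδ1 (μ := μ) hν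
  have hc0 : 0 ≤ 1 - δ := by linarith
  rw [shannonEntropy_of_absolutelyContinuous hacm]
  set P' := ∫⁻ x, ENNReal.ofReal (Real.negMulLog ((mixture δ μ ν).rnDeriv volume x).toReal)
  set N' := ∫⁻ x, ENNReal.ofReal (-Real.negMulLog ((mixture δ μ ν).rnDeriv volume x).toReal)
  have hP' : ENNReal.ofReal (1 - δ) * P ≤ P' := by
    rw [← lintegral_const_mul' _ _ ENNReal.ofReal_ne_top]
    refine lintegral_mono_ae ?_
    filter_upwards [hle] with x hx
    rw [← ENNReal.ofReal_mul hc0]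
    exact ENNReal.ofReal_le_ofReal hx
  have hN' : N' ≤ ENNReal.ofReal (1 - δ) * N := by
    rw [← lintegral_const_mul' _ _ ENNReal.ofReal_ne_top]
    refine lintegral_mono_ae ?_
    filter_upwards [hle] with x hx
    rw [← ENNReal.ofReal_mul hc0]
    exact ENNReal.ofReal_le_ofReal (by linarith)
  refine le_trans ?_ (EReal.sub_le_sub (EReal.coe_ennreal_le_coe_ennreal_iff.2 hP')
    (EReal.coe_ennreal_le_coe_ennreal_iff.2 hN'))
  exact EReal.sub_sub_le_mul_sub_mul hN hδ0 (by linarith) (by linarith)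

end Entropy

/-! ### The coupling of prescribed mutual information -/

theorem exists_nat_le_mul_log_sub {δ : ℝ} (hδ : 0 < δ) (ζ : ℝ) :
    ∃ k : ℕ, 0 < k ∧ 1 ≤ δ * k ∧ ζ ≤ δ * Real.log (δ * k) - δ := by
  have h1 : Filter.Tendsto (fun k : ℕ => δ * (k : ℝ)) .atTop .atTop :=
    tendsto_natCast_atTop_atTop.const_mul_atTop hδ
  have h2 : Filter.Tendsto (fun k : ℕ => δ * Real.log (δ * k) - δ) .atTop .atTop :=
    Filter.tendsto_atTop_add_const_right _ _
      ((Real.tendsto_log_atTop.comp h1).const_mul_atTop hδ)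
  exact ((Filter.eventually_gt_atTop 0).and ((h1.eventually_ge_atTop 1).and
    (h2.eventually_ge_atTop ζ))).exists

theorem absolutelyContinuous_of_shannonEntropy_ne_bot {E : Type*} [MeasureSpace E] {μ : Measure E}
    (h : shannonEntropy μ ≠ ⊥) : μ ≪ volume := by
  by_contra hac
  exact h (if_neg hac)

/-- The first coordinate of an absolutely continuous law has no atoms, so that it can be cut into
cells of equal mass. -/
theorem exists_monotone_cells_coord {ι : Type*} [Fintype ι] (i : ι)
    {μ : Measure (EuclideanSpace ℝ ι)} [IsProbabilityMeasure μ] (h : μ ≪ volume) {k : ℕ}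
    (hk : 0 < k) :
    ∃ J : ℝ → ℕ, Monotone J ∧ ∀ j < k, μ {x | J (x i) = j} = (k : ℝ≥0∞)⁻¹ := by
  have hm : Measurable fun x : EuclideanSpace ℝ ι => x i := by fun_prop
  have := Measure.isProbabilityMeasure_map (μ := μ) hm.aemeasurable
  obtain ⟨J, hJ, hJk⟩ := exists_monotone_cells (μ.map fun x => x i) (fun c => by
    rw [Measure.map_apply hm (measurableSet_singleton c)]
    exact h (EuclideanSpace.volume_coord_eq i c)) hk
  refine ⟨J, hJ, fun j hj => ?_⟩
  rw [← hJk j hj]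
  exact (Measure.map_apply hm (hJ.measurable (measurableSet_singleton j))).symm

theorem mainTheorem8 (n : ℕ) (hn : 1 ≤ n)
    (μZ : Measure (EuclideanSpace ℝ (Fin n)))
    (hZ : μZ ∈ finiteEntropyLaws (EuclideanSpace ℝ (Fin n)))
    (π : Measure (EuclideanSpace ℝ (Fin n) × EuclideanSpace ℝ (Fin n)))
    (hπ : π ∈ couplings (stdGaussian (EuclideanSpace ℝ (Fin n))) μZ)
    (ζ : ℝ≥0) (hI : mutualInformation π ≤ (ζ : ℝ≥0∞))
    (ε : ℝ) (hε : 0 < ε) :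
    ∃ π' ∈ couplings (stdGaussian (EuclideanSpace ℝ (Fin n))) μZ,
      shannonEntropy (sumLaw π') ≥ shannonEntropy (sumLaw π) - (ε : EReal) ∧
      mutualInformation π' = (ζ : ℝ≥0∞) := by
  obtain ⟨hprob, -, hbot, -⟩ := hZ
  set μX := stdGaussian (EuclideanSpace ℝ (Fin n)) with hμX
  have hXvol : μX ≤ volume := stdGaussian_le_volume (Fin n)
  have hπ_prob : IsProbabilityMeasure π :=
    ⟨by rw [← Measure.fst_univ, hπ.1]; exact measure_univ⟩
  have hadd : Measurable fun p : EuclideanSpace ℝ (Fin n) × EuclideanSpace ℝ (Fin n) =>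
    p.1 + p.2 := by fun_prop
  have hsum_prob : IsProbabilityMeasure (sumLaw π) :=
    Measure.isProbabilityMeasure_map hadd.aemeasurable
  -- The threshold `δ₀` depends on `π` and `ε` only; the number `k` of cells is adapted to it.
  obtain ⟨δ₀, hδ₀, hδ₀1, hent⟩ := exists_forall_shannonEntropy_mixture_ge (sumLaw π) hε
  obtain ⟨k, hk, hδk, hζ⟩ := exists_nat_le_mul_log_sub hδ₀ ζ
  let i : Fin n := ⟨0, hn⟩
  let u : EuclideanSpace ℝ (Fin n) →+ ℝ := (EuclideanSpace.proj (𝕜 := ℝ) i).toAddMonoidHom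
  have hu : Measurable u := (EuclideanSpace.proj (𝕜 := ℝ) i).continuous.measurable
  obtain ⟨J, hJ, hJk⟩ := exists_monotone_cells_coord i
    (Measure.absolutelyContinuous_of_le hXvol) hk
  obtain ⟨L, hL, hLk⟩ := exists_monotone_cells_coord i
    (absolutelyContinuous_of_shannonEntropy_ne_bot hbot) hk
  have hJu : Measurable (J ∘ u) := hJ.measurable.comp hu
  have hLu : Measurable (L ∘ u) := hL.measurable.comp hu
  have hσ : blockCoupling μX μZ k (J ∘ u) (L ∘ u) ∈ couplings μX μZ :=
    ⟨fst_blockCoupling hk hJu hLu hJk hLk, snd_blockCoupling hk hJu hLu hJk hLk⟩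
  have hσ_vol := sumLaw_blockCoupling_le hXvol hk hu hJ hL hLk
  have hσ_prob : IsProbabilityMeasure (blockCoupling μX μZ k (J ∘ u) (L ∘ u)) :=
    ⟨by rw [← Measure.fst_univ, hσ.1]; exact measure_univ⟩
  have hσ_sum : IsProbabilityMeasure (sumLaw (blockCoupling μX μZ k (J ∘ u) (L ∘ u))) :=
    Measure.isProbabilityMeasure_map hadd.aemeasurable
  rw [mutualInformation, hπ.1, hπ.2] at hI
  obtain ⟨δ, hδ, hkl⟩ := exists_klDiv_mixture_eq hI (measurableSet_matchingCells hJu hLu) hk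
    (prod_matchingCells hk hJu hLu hJk hLk) hδ₀.le hδ₀1 hδk hζ
  have hmem := mixture_mem_couplings hδ.1 (hδ.2.trans hδ₀1) hπ hσ
  refine ⟨_, hmem, ?_, ?_⟩
  · rw [sumLaw, map_mixture _ _ _ hadd]
    exact hent δ hδ _ hσ_vol
  · rw [mutualInformation, hmem.1, hmem.2]
    exact hkl
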